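/- Consider finite untyped $\lambda$-terms modulo renaming of bound variables, with $\beta$-reduction $\to_\beta$ (the compatible closure of $(\lambda x.P)Q \to P[x:=Q]$) and $\beta$-convertibility $=_\beta$ (its equivalence closure). A head normal form (hnf) is a term $\lambda x_1\ldots x_n.\,y M_1\ldots M_m$ with $n,m\ge 0$; a term has an hnf if it $\beta$-reduces to one. A head step is a step $\lambda x_1\ldots x_n.(\lambda y.P)Q N_1\ldots N_m \to_h \lambda x_1\ldots x_n.\,P[y:=Q] N_1\ldots N_m$; a term with an hnf reaches an hnf by a unique head reduction. The clocked Böhm tree $\mathrm{BT}_c(M)$ is the possibly infinite term, annotated with natural numbers at some nodes, defined coinductively: if $M$ has no hnf, it is $\bot$ (without annotation); if $M \to_h^k \lambda x_1\ldots x_n.\,y M_1\ldots M_m$ is the head reduction to hnf, it is $\lambda x_1\ldots x_n.\,y\,\mathrm{BT}_c(M_1)\ldots\mathrm{BT}_c(M_m)$ with its root annotated by $k$. Positions are finite sequences over $\{0,1,2\}$, where $0$ leads from an abstraction to its body and $1$, $2$ lead from an application to its function and its argument. We say that $M$ improves $N$ eventually if $\mathrm{BT}_c(M)$ and $\mathrm{BT}_c(N)$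 are equal after dropping all annotations and there is $\ell\in\mathbb N$ such that at every position $p$ of $\mathrm{BT}_c(M)$ of length at least $\ell$ either neither tree is annotated, or both are, with annotations $k_1$ in $\mathrm{BT}_c(M)$ and $k_2$ in $\mathrm{BT}_c(N)$ satisfying $k_1\le k_2$. A redex $(\lambda x.P)Q$ is simple if $x$ has at most one free occurrence in $P$ (linear) or $Q$ is a $\beta$-normal form (call-by-value). The set of simple terms is the largest set $X$ such that every $M\in X$ either has no hnf, or its head reduction to hnf $\lambda x_1\ldots x_n.\,y M_1\ldots M_m$ contracts only simple redexes and $M_1,\ldots,M_m\in X$. Theorem. Let $M$ and $N$ be $\lambda$-terms such that $M$ is simple. If $M$ does not improve $N$ eventually, then $M \ne_\beta N$. -/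

import Mathlib

/-- Finite `λ`-terms modulo renaming of bound variables, in de Bruijn notation: `var i` refers to
the `i`-th enclosing binder, and indices that exceed the number of enclosing binders are the
(countably many) free variables. -/
inductive LTerm : Type
  | var (i : ℕ) : LTerm
  | lam (M : LTerm) : LTerm
  | app (M N : LTerm) : LTerm

namespace LTerm

/-- A renaming of variables, pushed under a binder. -/
def upRen (ξ : ℕ → ℕ) : ℕ → ℕ
  | 0 => 0
  | i + 1 => ξ i + 1

/-- Renaming of the free variables. -/
def rename : (ℕ → ℕ) → LTerm → LTerm
  | ξ, var i => var (ξ i)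
  | ξ, lam M => lam (rename (upRen ξ) M)
  | ξ, app M N => app (rename ξ M) (rename ξ N)

/-- A substitution, pushed under a binder. -/
def upSub (σ : ℕ → LTerm) : ℕ → LTerm
  | 0 => var 0
  | i + 1 => rename Nat.succ (σ i)

/-- Simultaneous capture-avoiding substitution for the free variables. -/
def subst : (ℕ → LTerm) → LTerm → LTerm
  | σ, var i => σ i
  | σ, lam M => lam (subst (upSub σ) M)
  | σ, app M N => app (subst σ M) (subst σ N)

/-- The substitution of `N` for variable `0`; the other variables are lowered by one. -/
def single (N : LTerm) : ℕ → LTerm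
  | 0 => N
  | i + 1 => var i

/-- `M.inst N` is `M[x := N]`, the contractum of the redex `(λx.M) N`. -/
def inst (M N : LTerm) : LTerm := subst (single N) M

/-- The number of free occurrences of the variable `i` in a term. -/
def occ : ℕ → LTerm → ℕ
  | i, var j => if i = j then 1 else 0
  | i, lam M => occ (i + 1) M
  | i, app M N => occ i M + occ i N

/-- One-step `β`-reduction: the compatible closure of the `β`-rule. -/
inductive Step : LTerm → LTerm → Prop
  | beta (M N : LTerm) : Step (app (lam M) N) (M.inst N)
  | lam {M M' : LTerm} (h : Step M M') : Step (lam M) (lam M')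
  | appL {M M' : LTerm} (N : LTerm) (h : Step M M') : Step (app M N) (app M' N)
  | appR (M : LTerm) {N N' : LTerm} (h : Step N N') : Step (app M N) (app M N')

/-- Many-step `β`-reduction. -/
def Red : LTerm → LTerm → Prop := Relation.ReflTransGen Step

/-- `β`-convertibility: the equivalence closure of one-step `β`-reduction. -/
def Conv : LTerm → LTerm → Prop := Relation.EqvGen Step

/-- `β`-normal forms. -/
def IsNormal (M : LTerm) : Prop := ∀ M', ¬ Step M M'

/-- `lams n M` is `λx₁ … λxₙ. M`. -/
def lams : ℕ → LTerm → LTerm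
  | 0, M => M
  | n + 1, M => lam (lams n M)

/-- `apps M [N₁, …, Nₘ]` is `M N₁ … Nₘ`, associated to the left. -/
def apps (M : LTerm) (Ns : List LTerm) : LTerm := Ns.foldl app M

/-- `H` is a head normal form `λx₁ … λxₙ. y N₁ … Nₘ`. -/
def IsHnf (H : LTerm) : Prop := ∃ n y Ns, H = lams n (apps (var y) Ns)

/-- `M` has a head normal form, that is, it reduces to one. -/
def HasHnf (M : LTerm) : Prop := ∃ H, Red M H ∧ IsHnf H

/-- A head reduction step
`λx₁ … λxₙ. (λy.P) Q N₁ … Nₘ → λx₁ … λxₙ. P[y := Q] N₁ … Nₘ`. -/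
inductive HeadStep : LTerm → LTerm → Prop
  | mk (n : ℕ) (P Q : LTerm) (Ns : List LTerm) :
      HeadStep (lams n (apps (app (lam P) Q) Ns)) (lams n (apps (P.inst Q) Ns))

/-- `HeadRed k M N`: there is a head reduction from `M` to `N` of exactly `k` steps. -/
inductive HeadRed : ℕ → LTerm → LTerm → Prop
  | refl (M : LTerm) : HeadRed 0 M M
  | step {k : ℕ} {M P N : LTerm} (h : HeadStep M P) (h' : HeadRed k P N) : HeadRed (k + 1) M N

/-- The redex `(λx.P) Q` is linear: `x` has at most one occurrence in `P`. -/
def LinearRedex (P _Q : LTerm) : Prop := occ 0 P ≤ 1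

/-- The redex `(λx.P) Q` is call-by-value: `Q` is a normal form. -/
def CallByValueRedex (_P Q : LTerm) : Prop := IsNormal Q

/-- The redex `(λx.P) Q` is simple: it is linear or call-by-value. -/
def SimpleRedex (P Q : LTerm) : Prop := LinearRedex P Q ∨ CallByValueRedex P Q

/-- A head reduction step that contracts a simple redex. -/
inductive SimpleHeadStep : LTerm → LTerm → Prop
  | mk (n : ℕ) (P Q : LTerm) (Ns : List LTerm) (h : SimpleRedex P Q) :
      SimpleHeadStep (lams n (apps (app (lam P) Q) Ns)) (lams n (apps (P.inst Q) Ns))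

/-- The condition on a set `X` of terms of which the set of simple terms is the largest solution:
every `M ∈ X` has no head normal form, or its head reduction to head normal form contracts only
simple redexes and the arguments of that head normal form are again in `X`. -/
def SimpleClosed (X : Set LTerm) : Prop :=
  ∀ M ∈ X, ¬ HasHnf M ∨
    ∃ n y Ns, Relation.ReflTransGen SimpleHeadStep M (lams n (apps (var y) Ns)) ∧ ∀ N ∈ Ns, N ∈ X

/-- Simple terms (a coinductive notion: membership in the largest `SimpleClosed` set). -/
def Simple (M : LTerm) : Prop := ∃ X : Set LTerm, SimpleClosed X ∧ M ∈ X

end LTerm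

/-- The symbols at the nodes of a finite or infinite `λ`-term with `⊥`. -/
inductive NodeSym : Type
  | bot : NodeSym
  | var (i : ℕ) : NodeSym
  | lam : NodeSym
  | app : NodeSym

/-- A symbol together with an optional annotation by a natural number. -/
structure NodeLabel : Type where
  sym : NodeSym
  ann : Option ℕ

/-- Positions are sequences over `{0, 1, 2}`: `0` leads to the body of an abstraction, `1` and `2`
to the function and the argument of an application. -/
abbrev TreePos : Type := List (Fin 3)

/-- Finite or infinite annotated terms, given by the label at each position; the value at `p` is
`none` if `p` is not a position of the term. -/
abbrev AnnTree : Type := TreePos → Option NodeLabel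

namespace AnnTree

/-- The set of positions of an annotated term. -/
def positions (T : AnnTree) : Set TreePos := {p | (T p).isSome}

/-- The unannotated term obtained by dropping all annotations. -/
def deannotate (T : AnnTree) : TreePos → Option NodeSym := fun p => (T p).map NodeLabel.sym

/-- `p` is a position of both `T₁` and `T₂`, and at `p` either neither is annotated, or both are
and the annotations are related by `R`. -/
def RelAt (R : ℕ → ℕ → Prop) (T₁ T₂ : AnnTree) (p : TreePos) : Prop :=
  ∃ l₁ l₂, T₁ p = some l₁ ∧ T₂ p = some l₂ ∧
    ((l₁.ann = none ∧ l₂.ann = none) ∨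
      ∃ k₁ k₂, l₁.ann = some k₁ ∧ l₂.ann = some k₂ ∧ R k₁ k₂)

/-- `R` holds eventually between `T₁` and `T₂`: without annotations they are the same term, and
`R` holds at all positions from some depth on. -/
def RelEventually (R : ℕ → ℕ → Prop) (T₁ T₂ : AnnTree) : Prop :=
  T₁.deannotate = T₂.deannotate ∧
    ∃ l : ℕ, ∀ p ∈ T₁.positions, l ≤ p.length → RelAt R T₁ T₂ p

end AnnTree

namespace LTerm

/-- The states in the generation of a clocked Böhm tree: `eval M` is the root of the clocked Böhm
tree of `M`; `frame H` is an unannotated node inside a head normal form, where `H` is the subterm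
of the head normal form at that node and the arguments in `H` remain to be evaluated. -/
inductive BTState : Type
  | eval (M : LTerm) : BTState
  | frame (H : LTerm) : BTState

/-- The root symbol of a term. -/
def rootSym : LTerm → NodeSym
  | var i => NodeSym.var i
  | lam _ => NodeSym.lam
  | app _ _ => NodeSym.app

/-- The states at the children of a part of a head normal form: arguments are to be evaluated. -/
def frameChild : LTerm → Fin 3 → Option BTState
  | lam H, 0 => some (BTState.frame H)
  | app A _, 1 => some (BTState.frame A)
  | app _ B, 2 => some (BTState.eval B)
  | _, _ => none

/-- The length of the head reduction of `M` to head normal form, and that head normal form. It is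
meant for terms `M` that have a head normal form: then such a head reduction exists, and it is
unique because head reduction is deterministic and stops at head normal forms. -/
noncomputable def headReduct (M : LTerm) : ℕ × LTerm :=
  @Classical.epsilon _ ⟨(0, M)⟩ fun kH => HeadRed kH.1 M kH.2 ∧ IsHnf kH.2

open Classical in
/-- Evaluation of a state: `none` stands for `⊥` (no head normal form), and `some (a, H)` for a
part `H` of a head normal form with the optional annotation `a`. If `M` reduces to head normal form `H` by `k`
head steps, then `eval M` becomes `H` with annotation `k` at its root. -/
noncomputable def resolve : BTState → Option (Option ℕ × LTerm)
  | BTState.eval M => if HasHnf M then some (some (headReduct M).1, (headReduct M).2) else none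
  | BTState.frame H => some (none, H)

/-- The annotated term generated by a state. -/
noncomputable def unfold : BTState → AnnTree
  | s, [] =>
    match resolve s with
    | none => some ⟨NodeSym.bot, none⟩
    | some (a, H) => some ⟨rootSym H, a⟩
  | s, i :: p =>
    match resolve s with
    | none => none
    | some (_, H) => (frameChild H i).bind fun s' => unfold s' p

/-- The clocked Böhm tree of `M`: it is `⊥` if `M` has no head normal form; otherwise, if `M`
reduces by `k` head steps to the head normal form `λx₁ … λxₙ. y M₁ … Mₘ`, it is that term, annotated
by `k` at the root, with each `Mᵢ` replaced by its clocked Böhm tree. -/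
noncomputable def clockedBT (M : LTerm) : AnnTree := unfold (BTState.eval M)

/-- `M` improves `N` eventually: the annotations of the clocked Böhm tree of `M` are eventually at
most those of the clocked Böhm tree of `N`. -/
def ImprovesEventually (M N : LTerm) : Prop :=
  AnnTree.RelEventually (· ≤ ·) (clockedBT M) (clockedBT N)

end LTerm

/-! By confluence, convertible `M` and `N` have a common reduct `P`. Standardization arranges the
reduction from `M` to `P` as weak head reductions along the structure of `P`; their total number of
steps is a finite budget `w`. Suppose `M` head reduces to head normal form. Each head step of `M`
either belongs to the standard reduction, and uses up one unit of the budget, or is mirrored by a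
head step of `P` (`Std.headStep`). Passing to a reduct never lengthens head reduction
(`Red.headRed`), so `N` needs at least as many head steps as `P`. Hence an annotation of `M` exceeds
that of `N` only where budget is spent (`Tracks.headReduct`). The remaining budget is split among
the arguments, so at most `w` positions are worse (`StateTracks.encard_worsePositions_le`), and
their lengths are bounded.

Simplicity keeps the budget from growing when a mirrored step substitutes `B` into `A` (`Std.inst`):
a normal `B` has no reduction that could be copied, and otherwise the variable occurs at most once
in `A`. The difficulty is that the standard reduction of `A` may itself duplicate the variable, so
that the budget of `B` would be paid repeatedly. After the substitution, such a duplication is a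
nonsimple weak head step (`WeakStep.occ_le`), and `Std` gives terms with such steps weight zero.
Nothing is lost by this: the head reduction of a simple term with a head normal form never contracts
a nonsimple redex, and a term without one carries no annotation. -/

namespace LTerm

/-! ### Substitution calculus -/

theorem upRen_comp (ξ ζ : ℕ → ℕ) : upRen ζ ∘ upRen ξ = upRen (ζ ∘ ξ) := by
  funext i; cases i <;> rfl

theorem rename_rename (M : LTerm) : ∀ ξ ζ : ℕ → ℕ,
    rename ζ (rename ξ M) = rename (ζ ∘ ξ) M := by
  induction M with
  | var i => intro ξ ζ; rfl
  | lam M ih => intro ξ ζ; simp only [rename, ih, upRen_comp]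
  | app M N ihM ihN => intro ξ ζ; simp only [rename, ihM, ihN]

theorem upSub_comp_upRen (ξ : ℕ → ℕ) (σ : ℕ → LTerm) :
    upSub σ ∘ upRen ξ = upSub (σ ∘ ξ) := by
  funext i; cases i <;> rfl

theorem subst_rename (M : LTerm) : ∀ (ξ : ℕ → ℕ) (σ : ℕ → LTerm),
    subst σ (rename ξ M) = subst (σ ∘ ξ) M := by
  induction M with
  | var i => intro ξ σ; rfl
  | lam M ih => intro ξ σ; simp only [rename, subst, ih, upSub_comp_upRen]
  | app M N ihM ihN => intro ξ σ; simp only [rename, subst, ihM, ihN]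

theorem rename_upSub (ξ : ℕ → ℕ) (σ : ℕ → LTerm) :
    (fun i => rename (upRen ξ) (upSub σ i)) = upSub (fun i => rename ξ (σ i)) := by
  funext i
  cases i with
  | zero => rfl
  | succ i => simp only [upSub, rename_rename]; rfl

theorem rename_subst (M : LTerm) : ∀ (ξ : ℕ → ℕ) (σ : ℕ → LTerm),
    rename ξ (subst σ M) = subst (fun i => rename ξ (σ i)) M := by
  induction M with
  | var i => intro ξ σ; rfl
  | lam M ih => intro ξ σ; simp only [rename, subst, ih, rename_upSub]
  | app M N ihM ihN => intro ξ σ; simp only [rename, subst, ihM, ihN]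

theorem subst_upSub (σ τ : ℕ → LTerm) :
    (fun i => subst (upSub τ) (upSub σ i)) = upSub (fun i => subst τ (σ i)) := by
  funext i
  cases i with
  | zero => rfl
  | succ i => simp only [upSub, subst_rename, rename_subst]; rfl

theorem subst_subst (M : LTerm) : ∀ σ τ : ℕ → LTerm,
    subst τ (subst σ M) = subst (fun i => subst τ (σ i)) M := by
  induction M with
  | var i => intro σ τ; rfl
  | lam M ih => intro σ τ; simp only [subst, ih, subst_upSub]
  | app M N ihM ihN => intro σ τ; simp only [subst, ihM, ihN]

theorem upSub_var : upSub var = var := by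
  funext i; cases i <;> rfl

theorem subst_var (M : LTerm) : subst var M = M := by
  induction M with
  | var i => rfl
  | lam M ih => simp only [subst, upSub_var, ih]
  | app M N ihM ihN => simp only [subst, ihM, ihN]

theorem upSub_ren (ξ : ℕ → ℕ) : upSub (fun i => var (ξ i)) = fun i => var (upRen ξ i) := by
  funext i; cases i <;> rfl

theorem rename_eq_subst (M : LTerm) : ∀ ξ : ℕ → ℕ, rename ξ M = subst (fun i => var (ξ i)) M := by
  induction M with
  | var i => intro ξ; rfl
  | lam M ih => intro ξ; simp only [rename, subst, ih, upSub_ren]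
  | app M N ihM ihN => intro ξ; simp only [rename, subst, ihM, ihN]

theorem subst_inst (σ : ℕ → LTerm) (P Q : LTerm) :
    subst σ (P.inst Q) = (subst (upSub σ) P).inst (subst σ Q) := by
  simp only [inst, subst_subst]
  congr 1
  funext i
  cases i with
  | zero => rfl
  | succ i =>
    simp only [upSub, subst_rename, single, subst]
    exact (subst_var _).symm

/-! ### Occurrences -/

theorem occ_rename (M : LTerm) : ∀ (ξ : ℕ → ℕ) (x y : ℕ), (∀ i, x = ξ i ↔ y = i) →
    occ x (rename ξ M) = occ y M := by
  induction M with
  | var i => intro ξ x y h; simp only [rename, occ, h]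
  | lam M ih =>
    intro ξ x y h
    refine ih _ _ _ fun i => ?_
    cases i with
    | zero => simp [upRen]
    | succ i => simp [upRen, h]
  | app M N ihM ihN => intro ξ x y h; simp only [rename, occ, ihM _ _ _ h, ihN _ _ _ h]

theorem occ_rename_succ (M : LTerm) (x : ℕ) : occ (x + 1) (rename Nat.succ M) = occ x M :=
  occ_rename M _ _ _ fun i => by simp

/-- The hypothesis is the occurrence count of `single Q`, with `a = x + 1`, `b = 0` and `q = occ x
Q`, in a form that is stable under binders. -/
theorem occ_subst (M : LTerm) : ∀ (σ : ℕ → LTerm) (x a b q : ℕ),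
    (∀ i, occ x (σ i) = (if a = i then 1 else 0) + (if b = i then q else 0)) →
    occ x (subst σ M) = occ a M + occ b M * q := by
  induction M with
  | var i =>
    intro σ x a b q h
    simp only [subst, occ, h]
    split_ifs <;> simp
  | lam M ih =>
    intro σ x a b q h
    refine ih _ _ _ _ _ fun i => ?_
    cases i with
    | zero => simp [upSub, occ]
    | succ i => simp [upSub, occ_rename_succ, h]
  | app M N ihM ihN =>
    intro σ x a b q h
    simp only [subst, occ, ihM _ _ _ _ _ h, ihN _ _ _ _ _ h]
    ring

theorem occ_inst (P Q : LTerm) (x : ℕ) :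
    occ x (P.inst Q) = occ (x + 1) P + occ 0 P * occ x Q := by
  refine occ_subst P _ _ _ _ _ fun i => ?_
  cases i with
  | zero => simp [single]
  | succ i => simp [single, occ]

theorem occ_le_occ_subst (M : LTerm) : ∀ (σ : ℕ → LTerm) (x a : ℕ), 1 ≤ occ x (σ a) →
    occ a M ≤ occ x (subst σ M) := by
  induction M with
  | var i =>
    intro σ x a h
    simp only [subst, occ]
    split_ifs with hi
    · exact hi ▸ h
    · exact Nat.zero_le _
  | lam M ih =>
    intro σ x a h
    exact ih _ _ _ (by simpa only [upSub, occ_rename_succ] using h)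
  | app M N ihM ihN => intro σ x a h; exact Nat.add_le_add (ihM _ _ _ h) (ihN _ _ _ h)

/-! ### Reduction and substitution -/

theorem Step.subst {M N : LTerm} (h : Step M N) :
    ∀ σ : ℕ → LTerm, Step (M.subst σ) (N.subst σ) := by
  induction h with
  | beta M N => intro σ; rw [subst_inst]; exact Step.beta _ _
  | lam _ ih => intro σ; exact Step.lam (ih _)
  | appL N _ ih => intro σ; exact Step.appL _ (ih _)
  | appR M _ ih => intro σ; exact Step.appR _ (ih _)

theorem Step.rename {M N : LTerm} (h : Step M N) (ξ : ℕ → ℕ) :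
    Step (M.rename ξ) (N.rename ξ) := by
  rw [rename_eq_subst, rename_eq_subst]; exact h.subst _

theorem Red.map {M N : LTerm} (h : Red M N) (f : LTerm → LTerm)
    (hf : ∀ {X Y}, Step X Y → Step (f X) (f Y)) : Red (f M) (f N) := by
  induction h with
  | refl => exact Relation.ReflTransGen.refl
  | tail _ h ih => exact Relation.ReflTransGen.tail ih (hf h)

theorem Red.lam {M N : LTerm} (h : Red M N) : Red (M.lam) (N.lam) :=
  h.map LTerm.lam Step.lam

theorem Red.app {M M' N N' : LTerm} (h : Red M M') (h' : Red N N') :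
    Red (M.app N) (M'.app N') :=
  Relation.ReflTransGen.trans (h.map (fun X : LTerm => X.app N) (Step.appL N))
    (h'.map (fun X : LTerm => M'.app X) (Step.appR M'))

theorem Red.subst_left {M N : LTerm} (h : Red M N) (σ : ℕ → LTerm) :
    Red (M.subst σ) (N.subst σ) :=
  h.map (LTerm.subst σ) fun hs => hs.subst σ

theorem Red.rename {M N : LTerm} (h : Red M N) (ξ : ℕ → ℕ) :
    Red (M.rename ξ) (N.rename ξ) :=
  h.map (LTerm.rename ξ) fun hs => hs.rename ξ

theorem Red.subst_right (M : LTerm) : ∀ {σ τ : ℕ → LTerm}, (∀ i, Red (σ i) (τ i)) →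
    Red (M.subst σ) (M.subst τ) := by
  induction M with
  | var i => intro σ τ h; exact h i
  | lam M ih =>
    intro σ τ h
    refine Red.lam (ih fun i => ?_)
    cases i with
    | zero => exact Relation.ReflTransGen.refl
    | succ i => exact (h i).rename _
  | app M N ihM ihN => intro σ τ h; exact Red.app (ihM h) (ihN h)

theorem Red.inst {P P' Q Q' : LTerm} (h : Red P P') (h' : Red Q Q') :
    Red (P.inst Q) (P'.inst Q') := by
  refine Relation.ReflTransGen.trans (h.subst_left _) (Red.subst_right P' fun i => ?_)
  cases i with
  | zero => exact h'
  | succ i => exact Relation.ReflTransGen.refl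

theorem IsNormal.eq_of_red {M N : LTerm} (hM : IsNormal M) (h : Red M N) : N = M := by
  rcases Relation.ReflTransGen.cases_head h with h | ⟨X, hX, -⟩
  · exact h.symm
  · exact absurd hX (hM X)

theorem not_isNormal_rename {M : LTerm} (hM : ¬ IsNormal M) (ξ : ℕ → ℕ) :
    ¬ IsNormal (M.rename ξ) := by
  simp only [IsNormal, not_forall, not_not] at hM ⊢
  obtain ⟨N, hN⟩ := hM
  exact ⟨_, hN.rename ξ⟩

theorem not_isNormal_subst {M : LTerm} (hM : ¬ IsNormal M) (σ : ℕ → LTerm) :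
    ¬ IsNormal (M.subst σ) := by
  simp only [IsNormal, not_forall, not_not] at hM ⊢
  obtain ⟨N, hN⟩ := hM
  exact ⟨_, hN.subst σ⟩

/-- A redex of `σ x` survives at each occurrence of `x`. This is used contrapositively: an argument
that becomes normal under `σ` cannot contain `x`. -/
theorem not_isNormal_subst_of_occ (M : LTerm) : ∀ (σ : ℕ → LTerm) (x : ℕ),
    ¬ IsNormal (σ x) → occ x M ≠ 0 → ¬ IsNormal (M.subst σ) := by
  induction M with
  | var i =>
    intro σ x h hx
    have : x = i := by by_contra hne; exact hx (by simp [occ, hne])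
    exact this ▸ h
  | lam M ih =>
    intro σ x h hx hn
    exact ih (upSub σ) (x + 1) (not_isNormal_rename h _) hx fun N hN => hn _ (Step.lam hN)
  | app M N ihM ihN =>
    intro σ x h hx hn
    by_cases hM : occ x M = 0
    · exact ihN σ x h (fun h0 => hx (by simp [occ, hM, h0])) fun _ hN => hn _ (Step.appR _ hN)
    · exact ihM σ x h hM fun _ hN => hn _ (Step.appL _ hN)

/-! ### Confluence -/

/-- Parallel `β`-reduction. -/
inductive Par : LTerm → LTerm → Prop
  | var (i : ℕ) : Par (var i) (var i)
  | lam {M M' : LTerm} (h : Par M M') : Par (lam M) (lam M')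
  | app {M M' N N' : LTerm} (hM : Par M M') (hN : Par N N') : Par (app M N) (app M' N')
  | beta {M M' N N' : LTerm} (hM : Par M M') (hN : Par N N') :
      Par (app (lam M) N) (M'.inst N')

theorem Par.refl (M : LTerm) : Par M M := by
  induction M with
  | var i => exact .var i
  | lam M ih => exact .lam ih
  | app M N ihM ihN => exact .app ihM ihN

theorem Step.par {M N : LTerm} (h : Step M N) : Par M N := by
  induction h with
  | beta M N => exact .beta (.refl M) (.refl N)
  | lam _ ih => exact .lam ih
  | appL N _ ih => exact .app ih (.refl N)
  | appR M _ ih => exact .app (.refl M) ih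

theorem Par.red {M N : LTerm} (h : Par M N) : Red M N := by
  induction h with
  | var i => exact Relation.ReflTransGen.refl
  | lam _ ih => exact ih.lam
  | app _ _ ihM ihN => exact ihM.app ihN
  | beta _ _ ihM ihN =>
    exact Relation.ReflTransGen.head (Step.beta _ _) (ihM.inst ihN)

/-- The second hypothesis, closure under renaming, carries the induction under binders. It makes
`Par.rename` a special case instead of a prerequisite. -/
theorem Par.subst {M N : LTerm} (h : Par M N) : ∀ {σ τ : ℕ → LTerm},
    (∀ i, Par (σ i) (τ i)) → (∀ i, ∀ ξ : ℕ → ℕ, Par ((σ i).rename ξ) ((τ i).rename ξ)) →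
    Par (M.subst σ) (N.subst τ) := by
  have up : ∀ {σ τ : ℕ → LTerm},
      (∀ i, ∀ ξ : ℕ → ℕ, Par ((σ i).rename ξ) ((τ i).rename ξ)) →
      (∀ i, Par (upSub σ i) (upSub τ i)) ∧
      (∀ i, ∀ ξ : ℕ → ℕ, Par ((upSub σ i).rename ξ) ((upSub τ i).rename ξ)) := by
    intro σ τ h
    constructor
    · rintro (_ | i)
      · exact .var 0
      · exact h i _
    · rintro (_ | i) ξ
      · exact .var _
      · simp only [upSub, rename_rename]; exact h i _
  induction h with
  | var i => intro σ τ h _; exact h i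
  | lam _ ih => intro σ τ _ h'; exact .lam (ih (up h').1 (up h').2)
  | app _ _ ihM ihN => intro σ τ h h'; exact .app (ihM h h') (ihN h h')
  | beta _ _ ihM ihN =>
    intro σ τ h h'
    rw [subst_inst]
    exact .beta (ihM (up h').1 (up h').2) (ihN h h')

theorem Par.rename {M N : LTerm} (h : Par M N) (ξ : ℕ → ℕ) : Par (M.rename ξ) (N.rename ξ) := by
  rw [rename_eq_subst, rename_eq_subst]
  exact h.subst (fun i => .var _) (fun i ζ => .var _)

theorem Par.inst {P P' Q Q' : LTerm} (h : Par P P') (h' : Par Q Q') :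
    Par (P.inst Q) (P'.inst Q') := by
  refine h.subst ?_ ?_
  · rintro (_ | i)
    · exact h'
    · exact .var i
  · rintro (_ | i) ξ
    · exact h'.rename ξ
    · exact .var _

theorem Par.diamond {M N : LTerm} (h : Par M N) : ∀ {N' : LTerm}, Par M N' →
    ∃ K, Par N K ∧ Par N' K := by
  induction h with
  | var i => intro N' h'; cases h'; exact ⟨_, .var i, .var i⟩
  | lam _ ih =>
    intro N' h'
    cases h' with
    | lam h' => obtain ⟨K, h₁, h₂⟩ := ih h'; exact ⟨_, .lam h₁, .lam h₂⟩
  | app hM _ ihM ihN =>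
    intro N' h'
    cases h' with
    | app hM' hN' =>
      obtain ⟨K, h₁, h₂⟩ := ihM hM'
      obtain ⟨K', h₁', h₂'⟩ := ihN hN'
      exact ⟨_, .app h₁ h₁', .app h₂ h₂'⟩
    | beta hM' hN' =>
      obtain ⟨K', h₁', h₂'⟩ := ihN hN'
      obtain ⟨K, h₁, h₂⟩ := ihM (.lam hM')
      cases hM
      cases h₂ with
      | lam h₂ => cases h₁ with
        | lam h₁ => exact ⟨_, .beta h₁ h₁', h₂.inst h₂'⟩
  | beta hM _ ihM ihN =>
    intro N' h'
    cases h' with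
    | app hM' hN' =>
      cases hM' with
      | lam hM' =>
        obtain ⟨K, h₁, h₂⟩ := ihM hM'
        obtain ⟨K', h₁', h₂'⟩ := ihN hN'
        exact ⟨_, h₁.inst h₁', .beta h₂ h₂'⟩
    | beta hM' hN' =>
      obtain ⟨K, h₁, h₂⟩ := ihM hM'
      obtain ⟨K', h₁', h₂'⟩ := ihN hN'
      exact ⟨_, h₁.inst h₁', h₂.inst h₂'⟩

/-- Convertible terms have a common reduct. -/
theorem Conv.exists_red {M N : LTerm} (h : Conv M N) : ∃ P, Red M P ∧ Red N P := by
  have cr : ∀ a b c : LTerm, Par a b → Par a c →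
      ∃ d, Relation.ReflGen Par b d ∧ Relation.ReflTransGen Par c d := by
    intro a b c hb hc
    obtain ⟨d, h₁, h₂⟩ := hb.diamond hc
    exact ⟨d, .single h₁, .single h₂⟩
  have key : Relation.Join (Relation.ReflTransGen Par) M N := by
    have eqv := Relation.equivalence_join_reflTransGen cr
    induction h with
    | rel x y h => exact ⟨y, .single h.par, .refl⟩
    | refl x => exact eqv.refl x
    | symm x y _ ih => exact eqv.symm ih
    | trans x y z _ _ ih₁ ih₂ => exact eqv.trans ih₁ ih₂
  have red : ∀ {X Y : LTerm}, Relation.ReflTransGen Par X Y → Red X Y := by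
    intro X Y hXY
    induction hXY with
    | refl => exact Relation.ReflTransGen.refl
    | tail _ h ih => exact Relation.ReflTransGen.trans ih h.red
  obtain ⟨P, h₁, h₂⟩ := key
  exact ⟨P, red h₁, red h₂⟩

/-! ### Weak head reduction and head reduction -/

/-- `Iter R k M N`: `N` is reached from `M` by exactly `k` steps of `R`. -/
inductive Iter (R : LTerm → LTerm → Prop) : ℕ → LTerm → LTerm → Prop
  | refl (M : LTerm) : Iter R 0 M M
  | step {k : ℕ} {M P N : LTerm} (h : R M P) (h' : Iter R k P N) : Iter R (k + 1) M N

theorem Iter.trans {R : LTerm → LTerm → Prop} {j k : ℕ} {M N P : LTerm} (h : Iter R j M N)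
    (h' : Iter R k N P) : Iter R (j + k) M P := by
  induction h with
  | refl => rwa [Nat.zero_add]
  | step h _ ih => rw [Nat.add_right_comm]; exact .step h (ih h')

theorem Iter.map {R S : LTerm → LTerm → Prop} {k : ℕ} {M N : LTerm} (h : Iter R k M N)
    (f : LTerm → LTerm) (hf : ∀ {X Y}, R X Y → S (f X) (f Y)) : Iter S k (f M) (f N) := by
  induction h with
  | refl => exact .refl _
  | step h _ ih => exact .step (hf h) ih

theorem Iter.red {R : LTerm → LTerm → Prop} (hR : ∀ {X Y}, R X Y → Step X Y) {k : ℕ}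
    {M N : LTerm} (h : Iter R k M N) : Red M N := by
  induction h with
  | refl => exact Relation.ReflTransGen.refl
  | step h _ ih => exact Relation.ReflTransGen.head (hR h) ih

/-- A weak head step whose redex satisfies `G`. -/
inductive WeakStep (G : LTerm → LTerm → Prop) : LTerm → LTerm → Prop
  | beta (P Q : LTerm) (h : G P Q) : WeakStep G (app (lam P) Q) (P.inst Q)
  | appL {M M' : LTerm} (N : LTerm) (h : WeakStep G M M') : WeakStep G (app M N) (app M' N)

/-- A head step whose redex satisfies `G`. -/
inductive HStep (G : LTerm → LTerm → Prop) : LTerm → LTerm → Prop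
  | weak {M M' : LTerm} (h : WeakStep G M M') : HStep G M M'
  | lam {M M' : LTerm} (h : HStep G M M') : HStep G (lam M) (lam M')

/-- The condition on redexes that always holds. -/
def AnyRedex (_P _Q : LTerm) : Prop := True

/-- The redex `(λx.P) Q` is not simple. -/
def NonsimpleRedex (P Q : LTerm) : Prop := ¬ SimpleRedex P Q

theorem WeakStep.any {G : LTerm → LTerm → Prop} {M N : LTerm} (h : WeakStep G M N) :
    WeakStep AnyRedex M N := by
  induction h with
  | beta P Q _ => exact .beta P Q trivial
  | appL N _ ih => exact .appL N ih

theorem HStep.any {G : LTerm → LTerm → Prop} {M N : LTerm} (h : HStep G M N) :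
    HStep AnyRedex M N := by
  induction h with
  | weak h => exact .weak h.any
  | lam _ ih => exact .lam ih

theorem WeakStep.step {G : LTerm → LTerm → Prop} {M N : LTerm} (h : WeakStep G M N) :
    Step M N := by
  induction h with
  | beta P Q _ => exact .beta P Q
  | appL N _ ih => exact .appL N ih

theorem HStep.step {G : LTerm → LTerm → Prop} {M N : LTerm} (h : HStep G M N) :
    Step M N := by
  induction h with
  | weak h => exact h.step
  | lam _ ih => exact .lam ih

theorem not_weakStep_lam {G : LTerm → LTerm → Prop} {M N : LTerm} : ¬ WeakStep G (lam M) N := by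
  intro h; cases h

/-- Both steps contract the same redex, so the two conditions can be combined; a simple and a
nonsimple step from one term thereby contradict each other. -/
theorem WeakStep.deterministic {G G' : LTerm → LTerm → Prop} {M N : LTerm}
    (h : WeakStep G M N) : ∀ {N' : LTerm}, WeakStep G' M N' →
    N = N' ∧ WeakStep (fun P Q => G P Q ∧ G' P Q) M N := by
  induction h with
  | beta P Q hG =>
    intro N' h'
    cases h' with
    | beta _ _ hG' => exact ⟨rfl, .beta P Q ⟨hG, hG'⟩⟩
    | appL _ h' => exact absurd h' not_weakStep_lam
  | appL N h ih =>
    intro N' h'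
    cases h' with
    | beta _ _ hG' => exact absurd h not_weakStep_lam
    | appL _ h' =>
      obtain ⟨rfl, h''⟩ := ih h'
      exact ⟨rfl, .appL N h''⟩

theorem HStep.deterministic {G G' : LTerm → LTerm → Prop} {M N : LTerm}
    (h : HStep G M N) : ∀ {N' : LTerm}, HStep G' M N' →
    N = N' ∧ HStep (fun P Q => G P Q ∧ G' P Q) M N := by
  induction h with
  | weak h =>
    intro N' h'
    cases h' with
    | weak h' => exact ⟨(h.deterministic h').1, .weak (h.deterministic h').2⟩
    | lam h' => exact absurd h not_weakStep_lam
  | lam h ih =>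
    intro N' h'
    cases h' with
    | weak h' => exact absurd h' not_weakStep_lam
    | lam h' =>
      obtain ⟨rfl, h''⟩ := ih h'
      exact ⟨rfl, .lam h''⟩

theorem WeakStep.not_false {M N : LTerm} {G : LTerm → LTerm → Prop} (hG : ∀ P Q, ¬ G P Q)
    (h : WeakStep G M N) : False := by
  induction h with
  | beta P Q h => exact hG P Q h
  | appL _ _ ih => exact ih

theorem HStep.not_false {M N : LTerm} {G : LTerm → LTerm → Prop} (hG : ∀ P Q, ¬ G P Q)
    (h : HStep G M N) : False := by
  induction h with
  | weak h => exact h.not_false hG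
  | lam _ ih => exact ih

theorem occ_le_occ_upSub (P : LTerm) (σ : ℕ → LTerm) : occ 0 P ≤ occ 0 (P.subst (upSub σ)) :=
  occ_le_occ_subst P _ _ _ (by simp [upSub, occ])

/-- Substitution neither removes occurrences of the bound variable nor makes a reducible argument
normal. -/
theorem NonsimpleRedex.subst {P Q : LTerm} (h : NonsimpleRedex P Q) (σ : ℕ → LTerm) :
    NonsimpleRedex (P.subst (upSub σ)) (Q.subst σ) := by
  rintro (h' | h')
  · exact h (.inl ((occ_le_occ_upSub P σ).trans h'))
  · exact h (.inr (by_contra fun hn => not_isNormal_subst hn σ h'))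

theorem WeakStep.subst {G G' : LTerm → LTerm → Prop} {σ : ℕ → LTerm}
    (hG : ∀ P Q, G P Q → G' (P.subst (upSub σ)) (Q.subst σ)) {M N : LTerm}
    (h : WeakStep G M N) : WeakStep G' (M.subst σ) (N.subst σ) := by
  induction h with
  | beta P Q h => rw [subst_inst]; exact .beta _ _ (hG P Q h)
  | appL N _ ih => exact .appL _ ih

/-- Weak head reduction with the number of its steps. -/
abbrev WeakRed : ℕ → LTerm → LTerm → Prop := Iter (WeakStep AnyRedex)

theorem WeakRed.subst {k : ℕ} {M N : LTerm} (h : WeakRed k M N) (σ : ℕ → LTerm) :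
    WeakRed k (M.subst σ) (N.subst σ) :=
  Iter.map h _ fun hs => hs.subst fun _ _ _ => trivial

theorem WeakRed.appL {k : ℕ} {M N : LTerm} (h : WeakRed k M N) (K : LTerm) :
    WeakRed k (M.app K) (N.app K) :=
  Iter.map h (fun X : LTerm => X.app K) fun hs => .appL K hs

theorem WeakRed.of_lam {k : ℕ} {A N : LTerm} (h : WeakRed k (lam A) N) : k = 0 ∧ N = lam A := by
  cases h with
  | refl => exact ⟨rfl, rfl⟩
  | step h _ => exact absurd h not_weakStep_lam

/-- The weak head reduction of `M` contracts some redex that is not simple. -/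
def WeakNonsimple (M : LTerm) : Prop :=
  ∃ k X Y, WeakRed k M X ∧ WeakStep NonsimpleRedex X Y

theorem WeakNonsimple.of_weakRed {k : ℕ} {M N : LTerm} (h : WeakRed k M N)
    (hN : WeakNonsimple N) : WeakNonsimple M := by
  obtain ⟨j, X, Y, hX, hY⟩ := hN
  exact ⟨_, X, Y, h.trans hX, hY⟩

theorem WeakNonsimple.subst {M : LTerm} (h : WeakNonsimple M) (σ : ℕ → LTerm) :
    WeakNonsimple (M.subst σ) := by
  obtain ⟨j, X, Y, hX, hY⟩ := h
  exact ⟨j, _, _, hX.subst σ, hY.subst fun _ _ h => h.subst σ⟩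

theorem WeakNonsimple.appL {M : LTerm} (h : WeakNonsimple M) (K : LTerm) :
    WeakNonsimple (M.app K) := by
  obtain ⟨j, X, Y, hX, hY⟩ := h
  exact ⟨j, _, _, hX.appL K, .appL K hY⟩

theorem not_weakNonsimple_lam {A : LTerm} : ¬ WeakNonsimple (lam A) := by
  rintro ⟨k, X, Y, hX, hY⟩
  obtain ⟨-, rfl⟩ := hX.of_lam
  exact not_weakStep_lam hY

/-! ### Weighted standard reduction -/

/-- Standard reduction from `M` to `P`, built up along the structure of `P`. The weight bounds the
total number of weak head steps, but those of terms with a nonsimple weak head reduction, and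
everything below them, count for nothing. -/
inductive Std : ℕ → LTerm → LTerm → Prop
  | var {w k : ℕ} {M : LTerm} {i : ℕ} (h : WeakRed k M (var i)) (hw : WeakNonsimple M ∨ k ≤ w) :
      Std w M (var i)
  | lam {w k a : ℕ} {M A A' : LTerm} (h : WeakRed k M (lam A)) (hA : Std a A A')
      (hw : WeakNonsimple M ∨ k + a ≤ w) : Std w M (lam A')
  | app {w k a b : ℕ} {M A A' B B' : LTerm} (h : WeakRed k M (app A B)) (hA : Std a A A')
      (hB : Std b B B') (hw : WeakNonsimple M ∨ k + (a + b) ≤ w) : Std w M (app A' B')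

theorem Std.refl (M : LTerm) : Std 0 M M := by
  induction M with
  | var i => exact .var (.refl _) (.inr le_rfl)
  | lam M ih => exact .lam (.refl _) ih (.inr le_rfl)
  | app M N ihM ihN => exact .app (.refl _) ihM ihN (.inr le_rfl)

theorem Std.mono {v w : ℕ} {M N : LTerm} (h : Std v M N) (hvw : WeakNonsimple M ∨ v ≤ w) :
    Std w M N := by
  cases h with
  | var h hw => exact .var h (hw.elim .inl fun hw => hvw.imp_right hw.trans)
  | lam h hA hw => exact .lam h hA (hw.elim .inl fun hw => hvw.imp_right hw.trans)
  | app h hA hB hw => exact .app h hA hB (hw.elim .inl fun hw => hvw.imp_right hw.trans)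

theorem Std.red {w : ℕ} {M N : LTerm} (h : Std w M N) : Red M N := by
  induction h with
  | var h _ => exact Iter.red WeakStep.step h
  | lam h _ _ ih => exact Relation.ReflTransGen.trans (Iter.red WeakStep.step h) ih.lam
  | app h _ _ _ ihA ihB =>
    exact Relation.ReflTransGen.trans (Iter.red WeakStep.step h) (ihA.app ihB)

/-- The `k` steps are prepended to the root reduction; a nonsimple step from `X` is also one from
`M`, so zero weights remain justified. -/
theorem Std.of_weakRed {k w : ℕ} {M X P : LTerm} (h : WeakRed k M X) (hX : Std w X P) :
    Std (k + w) M P := by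
  cases hX with
  | var hX hw => exact .var (h.trans hX) (hw.imp (.of_weakRed h) (by omega))
  | lam hX hA hw => exact .lam (h.trans hX) hA (hw.imp (.of_weakRed h) (by omega))
  | app hX hA hB hw => exact .app (h.trans hX) hA hB (hw.imp (.of_weakRed h) (by omega))

/-- The substituted terms are not reduced, so their copies cost nothing, however many there are. -/
theorem Std.subst_same {a : ℕ} {A A' : LTerm} (h : Std a A A') :
    ∀ σ : ℕ → LTerm, Std a (A.subst σ) (A'.subst σ) := by
  induction h with
  | @var w k M i h hw =>
    intro σ
    exact ((Std.refl (σ i)).of_weakRed (h.subst σ)).mono (hw.imp_left (·.subst σ))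
  | lam h _ hw ih => intro σ; exact .lam (h.subst σ) (ih _) (hw.imp_left (·.subst σ))
  | app h _ _ hw ihA ihB =>
    intro σ; exact .app (h.subst σ) (ihA σ) (ihB σ) (hw.imp_left (·.subst σ))

theorem Std.rename {a : ℕ} {A A' : LTerm} (h : Std a A A') (ξ : ℕ → ℕ) :
    Std a (A.rename ξ) (A'.rename ξ) := by
  rw [rename_eq_subst, rename_eq_subst]; exact h.subst_same _

/-- After substitution the redex is simple. If linear, it does not copy its argument; if
call-by-value, its argument does not contain `x`, as `σ x` is reducible. In neither case is `x`
duplicated. -/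
theorem WeakStep.occ_le {σ : ℕ → LTerm} {x : ℕ} (hx : ¬ IsNormal (σ x)) {G : LTerm → LTerm → Prop}
    {M N : LTerm} (h : WeakStep G M N) :
    ¬ WeakNonsimple (M.subst σ) → occ x N ≤ occ x M := by
  induction h with
  | beta P Q _ =>
    intro hM
    rw [occ_inst]
    refine Nat.add_le_add_left ?_ _
    have hs : SimpleRedex (P.subst (upSub σ)) (Q.subst σ) :=
      by_contra fun hn => hM ⟨0, _, _, .refl _, .beta _ _ hn⟩
    rcases hs with hs | hs
    · calc occ 0 P * occ x Q ≤ 1 * occ x Q :=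
            Nat.mul_le_mul_right _ ((occ_le_occ_upSub P σ).trans hs)
        _ = occ x Q := Nat.one_mul _
    · have : occ x Q = 0 := by_contra fun hn => not_isNormal_subst_of_occ Q σ x hx hn hs
      simp [this]
  | appL N _ ih =>
    intro hM
    exact Nat.add_le_add_right (ih fun hn => hM (hn.appL _)) _

theorem WeakRed.occ_le {σ : ℕ → LTerm} {x : ℕ} (hx : ¬ IsNormal (σ x)) {k : ℕ} {M N : LTerm}
    (h : WeakRed k M N) : ¬ WeakNonsimple (M.subst σ) → occ x N ≤ occ x M := by
  induction h with
  | refl => intro _; exact le_rfl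
  | step h _ ih =>
    intro hM
    refine (ih fun hn => hM ?_).trans (h.occ_le hx hM)
    exact hn.of_weakRed (.step (h.subst fun _ _ _ => trivial) (.refl _))

/-- Standard reduction is compatible with substitution. If the substituted term is not normal but
its variable occurs at most once, then the weights just add up. -/
theorem Std.subst_update {a b : ℕ} {A A' : LTerm} (h : Std a A A') :
    ∀ {x : ℕ} {σ τ : ℕ → LTerm}, (∀ i, i ≠ x → σ i = τ i) → Std b (σ x) (τ x) →
    ∃ u, Std u (A.subst σ) (A'.subst τ) ∧
      (occ x A ≤ 1 → ¬ IsNormal (σ x) → u ≤ a + occ x A * b) := by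
  -- A term with a nonsimple weak head reduction can be given weight 0, so the bound needs proof
  -- only for the others, where occurrences cannot multiply.
  have key : ∀ {X P : LTerm} {v w : ℕ} {Q R : Prop}, Std v X P →
      (¬ WeakNonsimple X → Q → R → v ≤ w) → ∃ u, Std u X P ∧ (Q → R → u ≤ w) := by
    intro X P v w Q R h hw
    by_cases hX : WeakNonsimple X
    · exact ⟨0, h.mono (.inl hX), fun _ _ => Nat.zero_le _⟩
    · exact ⟨v, h, hw hX⟩
  induction h with
  | @var w k M i h hw =>
    intro x σ τ hστ hb
    by_cases hi : i = x
    · subst hi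
      refine key (hb.of_weakRed (h.subst σ)) fun hn h1 hx => ?_
      have := WeakRed.occ_le hx h hn
      simp only [occ, if_true] at this
      have hk := hw.resolve_left fun hn' => hn (hn'.subst σ)
      -- The reduct is `x` itself, so `x` occurs in `M` at least once and the term `occ x M * b`
      -- pays for the appended reduction of `σ x`.
      nlinarith
    · refine key ((hστ i hi ▸ Std.refl (σ i) : Std 0 (σ i) (τ i)).of_weakRed (h.subst σ))
        fun hn h1 hx => ?_
      have hk := hw.resolve_left fun hn' => hn (hn'.subst σ)
      omega
  | @lam w k a M A A' h _ hw ih =>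
    intro x σ τ hστ hb
    obtain ⟨u, hu, hu'⟩ := ih (x := x + 1) (σ := upSub σ) (τ := upSub τ)
      (by rintro (_ | i) hi
          · rfl
          · simp only [upSub, hστ i (by simpa using hi)]) (hb.rename _)
    refine key (Std.lam (h.subst σ) hu (.inr le_rfl)) fun hn h1 hx => ?_
    have ho : occ (x + 1) A ≤ occ x M := WeakRed.occ_le hx h hn
    have hk := hw.resolve_left fun hn' => hn (hn'.subst σ)
    have := hu' (ho.trans h1) (not_isNormal_rename hx _)
    have := Nat.mul_le_mul_right b ho
    omega
  | @app w k a c M A A' B B' h _ _ hw ihA ihB =>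
    intro x σ τ hστ hb
    obtain ⟨u, hu, hu'⟩ := ihA hστ hb
    obtain ⟨v, hv, hv'⟩ := ihB hστ hb
    refine key (Std.app (h.subst σ) hu hv (.inr le_rfl)) fun hn h1 hx => ?_
    have ho : occ x A + occ x B ≤ occ x M := WeakRed.occ_le hx h hn
    have hk := hw.resolve_left fun hn' => hn (hn'.subst σ)
    have := hu' (by omega) hx
    have := hv' (by omega) hx
    have := Nat.mul_le_mul_right b ho
    rw [Nat.add_mul] at this
    omega

theorem Std.inst {a b : ℕ} {A A' B B' : LTerm} (hA : Std a A A') (hB : Std b B B') :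
    ∃ u, Std u (A.inst B) (A'.inst B') ∧ (SimpleRedex A B → u ≤ a + b) := by
  by_cases hn : IsNormal B
  · obtain rfl := hn.eq_of_red hB.red
    exact ⟨a, hA.subst_same _, fun _ => Nat.le_add_right _ _⟩
  · obtain ⟨u, hu, hu'⟩ := hA.subst_update (x := 0) (σ := single B) (τ := single B')
      (by rintro (_ | i) hi
          · exact absurd rfl hi
          · rfl) hB
    refine ⟨u, hu, fun hs => ?_⟩
    have h1 : occ 0 A ≤ 1 := hs.resolve_right hn
    have := hu' h1 hn
    have := Nat.mul_le_mul_right b h1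
    omega

/-- A step on the right may increase the weight arbitrarily: only finiteness of the initial budget
matters. -/
theorem Std.tail_step {N N' : LTerm} (hs : Step N N') :
    ∀ {w : ℕ} {M : LTerm}, Std w M N → ∃ v, Std v M N' := by
  induction hs with
  | beta C B =>
    intro w M h
    cases h with
    | app h hA hB _ =>
      cases hA with
      | lam h' hC _ =>
        obtain ⟨u, hu, -⟩ := hC.inst hB
        exact ⟨_, hu.of_weakRed (h.trans ((h'.appL _).trans (.step (.beta _ _ trivial) (.refl _))))⟩
  | lam _ ih =>
    intro w M h
    cases h with
    | lam h hA _ => obtain ⟨v, hv⟩ := ih hA; exact ⟨_, .lam h hv (.inr le_rfl)⟩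
  | appL N _ ih =>
    intro w M h
    cases h with
    | app h hA hB _ => obtain ⟨v, hv⟩ := ih hA; exact ⟨_, .app h hv hB (.inr le_rfl)⟩
  | appR N _ ih =>
    intro w M h
    cases h with
    | app h hA hB _ => obtain ⟨v, hv⟩ := ih hB; exact ⟨_, .app h hA hv (.inr le_rfl)⟩

/-- Standardization. -/
theorem Red.exists_std {M N : LTerm} (h : Red M N) : ∃ w, Std w M N := by
  induction h with
  | refl => exact ⟨0, .refl M⟩
  | tail _ hs ih => obtain ⟨w, hw⟩ := ih; exact Std.tail_step hs hw

/-! ### Standard reduction along head steps -/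

theorem WeakRed.tail_of_weakStep {k : ℕ} {G : LTerm → LTerm → Prop} {M M₁ N : LTerm}
    (h : WeakRed k M N) (hs : WeakStep G M M₁) :
    (k = 0 ∧ N = M) ∨ ∃ j, k = j + 1 ∧ WeakRed j M₁ N := by
  cases h with
  | refl => exact .inl ⟨rfl, rfl⟩
  | step h h' =>
    obtain ⟨rfl, -⟩ := hs.deterministic h
    exact .inr ⟨_, rfl, h'⟩

/-- By determinism the root reduction, if nonempty, starts with the given step, which saves one
unit. If it is empty, `M` must be an application and `P` is built from its two parts. -/
theorem Std.cases_weakStep {G : LTerm → LTerm → Prop} {w : ℕ} {M M₁ P : LTerm}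
    (hs : WeakStep G M M₁) (hM : ¬ WeakNonsimple M) (h : Std w M P) :
    (∃ v, Std v M₁ P ∧ v + 1 ≤ w) ∨ ∃ A B A' B' a b,
      M = LTerm.app A B ∧ P = LTerm.app A' B' ∧ Std a A A' ∧ Std b B B' ∧ a + b ≤ w := by
  cases h with
  | var h hw =>
    obtain ⟨-, rfl⟩ | ⟨j, rfl, h'⟩ := h.tail_of_weakStep hs
    · cases hs
    · exact .inl ⟨j, .var h' (.inr le_rfl), hw.resolve_left hM⟩
  | lam h hA hw =>
    obtain ⟨-, rfl⟩ | ⟨j, rfl, h'⟩ := h.tail_of_weakStep hs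
    · cases hs
    · exact .inl ⟨_, .lam h' hA (.inr le_rfl), by have := hw.resolve_left hM; omega⟩
  | app h hA hB hw =>
    have hk := hw.resolve_left hM
    obtain ⟨rfl, rfl⟩ | ⟨j, rfl, h'⟩ := h.tail_of_weakStep hs
    · exact .inr ⟨_, _, _, _, _, _, rfl, rfl, hA, hB, by omega⟩
    · exact .inl ⟨_, .app h' hA hB (.inr le_rfl), by omega⟩

theorem Std.of_lam {w : ℕ} {A P : LTerm} (h : Std w (LTerm.lam A) P) :
    ∃ A', P = LTerm.lam A' ∧ Std w A A' := by
  cases h with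
  | var h _ => cases h.of_lam.2
  | app h _ _ _ => cases h.of_lam.2
  | lam h hA hw =>
    obtain ⟨rfl, h'⟩ := h.of_lam
    cases h'
    exact ⟨_, rfl, hA.mono (.inr (by simpa using hw.resolve_left not_weakNonsimple_lam))⟩

/-- If the standard reduction leaves the head redex uncontracted, `P` has a residual of it in head
position. Contracting that residual does not raise the weight, by `Std.inst`. -/
theorem Std.weakStep {M M₁ : LTerm} (hs : WeakStep SimpleRedex M M₁) :
    ∀ {w : ℕ} {P : LTerm}, ¬ WeakNonsimple M → Std w M P →
      (∃ v, Std v M₁ P ∧ v + 1 ≤ w) ∨ ∃ P₁, WeakStep AnyRedex P P₁ ∧ Std w M₁ P₁ := by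
  induction hs with
  | beta C B hG =>
    intro w P hM h
    refine (h.cases_weakStep (.beta C B hG) hM).imp_right ?_
    rintro ⟨A, B, A', B', a, b, hAB, rfl, hA, hB, hw⟩
    cases hAB
    obtain ⟨C', rfl, hC⟩ := hA.of_lam
    obtain ⟨u, hu, hu'⟩ := hC.inst hB
    exact ⟨_, .beta _ _ trivial, hu.mono (.inr ((hu' hG).trans hw))⟩
  | appL N hs ih =>
    intro w P hM h
    rcases h.cases_weakStep (.appL N hs) hM with h' | ⟨A, B, A', B', a, b, hAB, rfl, hA, hB, hw⟩
    · exact .inl h'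
    · cases hAB
      rcases ih (fun hn => hM (hn.appL _)) hA with ⟨v, hv, hva⟩ | ⟨P₁, hP, hv⟩
      · exact .inl ⟨_, .app (.refl _) hv hB (.inr le_rfl), by omega⟩
      · exact .inr ⟨_, .appL _ hP, .app (.refl _) hv hB (.inr (by omega))⟩

/-- The head reduction of `M` contracts some redex that is not simple. -/
def HeadNonsimple (M : LTerm) : Prop :=
  ∃ k X Y, Iter (HStep AnyRedex) k M X ∧ HStep NonsimpleRedex X Y

theorem WeakNonsimple.head {M : LTerm} (h : WeakNonsimple M) : HeadNonsimple M := by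
  obtain ⟨k, X, Y, hX, hY⟩ := h
  exact ⟨k, X, Y, hX.map id .weak, .weak hY⟩

theorem HeadNonsimple.lam {M : LTerm} (h : HeadNonsimple M) : HeadNonsimple (LTerm.lam M) := by
  obtain ⟨k, X, Y, hX, hY⟩ := h
  exact ⟨k, _, _, hX.map _ .lam, .lam hY⟩

theorem HeadNonsimple.of_step {G : LTerm → LTerm → Prop} {M M₁ : LTerm} (hs : HStep G M M₁)
    (h : HeadNonsimple M₁) : HeadNonsimple M := by
  obtain ⟨k, X, Y, hX, hY⟩ := h
  exact ⟨_, X, Y, .step hs.any hX, hY⟩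

theorem Std.headStep {M M₁ : LTerm} (hs : HStep SimpleRedex M M₁) :
    ∀ {w : ℕ} {P : LTerm}, ¬ HeadNonsimple M → Std w M P →
      (∃ v, Std v M₁ P ∧ v + 1 ≤ w) ∨ ∃ P₁, HStep AnyRedex P P₁ ∧ Std w M₁ P₁ := by
  induction hs with
  | weak hs =>
    intro w P hM h
    exact (Std.weakStep hs (fun hn => hM hn.head) h).imp_right
      fun ⟨P₁, hP, h'⟩ => ⟨P₁, .weak hP, h'⟩
  | lam hs ih =>
    intro w P hM h
    obtain ⟨A', rfl, hA⟩ := h.of_lam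
    rcases ih (fun hn => hM hn.lam) hA with ⟨v, hv, hvw⟩ | ⟨P₁, hP, hv⟩
    · exact .inl ⟨_, .lam (.refl _) hv (.inr le_rfl), by omega⟩
    · exact .inr ⟨_, .lam hP, .lam (.refl _) hv (.inr (by omega))⟩

/-- Each of the `k` steps is matched by one of the `j` steps or paid for by one of the `w - v`
units. -/
theorem Std.headRed {k : ℕ} {M H : LTerm} (hs : Iter (HStep SimpleRedex) k M H) :
    ∀ {w : ℕ} {P : LTerm}, ¬ HeadNonsimple M → Std w M P →
      ∃ j v P', Iter (HStep AnyRedex) j P P' ∧ Std v H P' ∧ k + v ≤ j + w ∧ v ≤ w := by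
  induction hs with
  | refl => intro w P _ h; exact ⟨0, w, P, .refl _, h, le_rfl, le_rfl⟩
  | step hs _ ih =>
    intro w P hM h
    rcases Std.headStep hs hM h with ⟨v, hv, hvw⟩ | ⟨P₁, hP, hv⟩
    · obtain ⟨j, u, P', h₁, h₂, h₃, h₄⟩ := ih (fun hn => hM (hn.of_step hs)) hv
      exact ⟨j, u, P', h₁, h₂, by omega, by omega⟩
    · obtain ⟨j, u, P', h₁, h₂, h₃, h₄⟩ := ih (fun hn => hM (hn.of_step hs)) hv
      exact ⟨j + 1, u, P', .step hP h₁, h₂, by omega, h₄⟩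

/-! ### Reduction along head steps -/

/-- A step other than the head step itself leaves one residual of the head redex, again in head
position. Closing the square may need several steps, as the argument can be copied. -/
theorem Step.weakStep {M M₁ : LTerm} (hs : WeakStep AnyRedex M M₁) :
    ∀ {N : LTerm}, Step M N → Red M₁ N ∨ ∃ N₁, WeakStep AnyRedex N N₁ ∧ Red M₁ N₁ := by
  induction hs with
  | beta P Q _ =>
    intro N h
    cases h with
    | beta => exact .inl .refl
    | appL _ h =>
      cases h with
      | lam h =>
        exact .inr ⟨_, .beta _ _ trivial, Red.inst (.single h) .refl⟩
    | appR _ h => exact .inr ⟨_, .beta _ _ trivial, Red.inst .refl (.single h)⟩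
  | appL K hs ih =>
    intro N h
    cases h with
    | beta => exact absurd hs not_weakStep_lam
    | appL _ h =>
      rcases ih h with h | ⟨N₁, h₁, h₂⟩
      · exact .inl (h.app .refl)
      · exact .inr ⟨_, .appL K h₁, h₂.app .refl⟩
    | appR _ h => exact .inr ⟨_, .appL _ hs, Red.app .refl (.single h)⟩

theorem Step.headStep {M M₁ : LTerm} (hs : HStep AnyRedex M M₁) :
    ∀ {N : LTerm}, Step M N → Red M₁ N ∨ ∃ N₁, HStep AnyRedex N N₁ ∧ Red M₁ N₁ := by
  induction hs with
  | weak hs =>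
    intro N h
    exact (h.weakStep hs).imp_right fun ⟨N₁, h₁, h₂⟩ => ⟨N₁, .weak h₁, h₂⟩
  | lam _ ih =>
    intro N h
    cases h with
    | lam h =>
      rcases ih h with h | ⟨N₁, h₁, h₂⟩
      · exact .inl h.lam
      · exact .inr ⟨_, .lam h₁, h₂.lam⟩

theorem Red.headStep {M N : LTerm} (h : Red M N) :
    ∀ {M₁ : LTerm}, HStep AnyRedex M M₁ →
      Red M₁ N ∨ ∃ N₁, HStep AnyRedex N N₁ ∧ Red M₁ N₁ := by
  induction h with
  | refl => intro M₁ hs; exact .inr ⟨_, hs, .refl⟩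
  | tail _ h ih =>
    intro M₁ hs
    rcases ih hs with h' | ⟨N₁, h₁, h₂⟩
    · exact .inl (Relation.ReflTransGen.tail h' h)
    · rcases h.headStep h₁ with h' | ⟨N₂, h₃, h₄⟩
      · exact .inl (Relation.ReflTransGen.trans h₂ h')
      · exact .inr ⟨N₂, h₃, Relation.ReflTransGen.trans h₂ h₄⟩

/-- Each head step is either absorbed by the reduction or projects to a single head step, so the
projected head reduction is no longer. -/
theorem Red.headRed {k : ℕ} {M H : LTerm} (hs : Iter (HStep AnyRedex) k M H) :
    ∀ {N : LTerm}, Red M N → ∃ j N', Iter (HStep AnyRedex) j N N' ∧ Red H N' ∧ j ≤ k := by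
  induction hs with
  | refl => intro N h; exact ⟨0, N, .refl _, h, le_rfl⟩
  | step hs _ ih =>
    intro N h
    rcases h.headStep hs with h | ⟨N₁, h₁, h₂⟩
    · obtain ⟨j, N', h₁, h₂, h₃⟩ := ih h
      exact ⟨j, N', h₁, h₂, h₃.trans (Nat.le_succ _)⟩
    · obtain ⟨j, N', h₃, h₄, h₅⟩ := ih h₂
      exact ⟨j + 1, N', .step h₁ h₃, h₄, Nat.succ_le_succ h₅⟩

/-! ### Head normal forms -/

/-- Terms `y N₁ … Nₘ` whose arguments satisfy `X`. -/
inductive Neutral (X : LTerm → Prop) : LTerm → Prop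
  | var (y : ℕ) : Neutral X (var y)
  | app {M N : LTerm} (hM : Neutral X M) (hN : X N) : Neutral X (app M N)

/-- Head normal forms whose arguments satisfy `X`. -/
inductive HeadNormal (X : LTerm → Prop) : LTerm → Prop
  | neutral {M : LTerm} (h : Neutral X M) : HeadNormal X M
  | lam {M : LTerm} (h : HeadNormal X M) : HeadNormal X (lam M)

theorem Neutral.apps {X : LTerm → Prop} (Ns : List LTerm) : ∀ {M : LTerm}, Neutral X M →
    (∀ N ∈ Ns, X N) → Neutral X (M.apps Ns) := by
  induction Ns with
  | nil => intro M h _; exact h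
  | cons N Ns ih =>
    intro M h hX
    exact ih (h.app (hX N (by simp))) fun K hK => hX K (by simp [hK])

theorem headNormal_lams_apps {X : LTerm → Prop} (n y : ℕ) {Ns : List LTerm}
    (h : ∀ N ∈ Ns, X N) : HeadNormal X (lams n (apps (var y) Ns)) := by
  induction n with
  | zero => exact .neutral (.apps Ns (.var y) h)
  | succ n ih => exact .lam ih

theorem Neutral.exists_apps {X : LTerm → Prop} {M : LTerm} (h : Neutral X M) :
    ∃ y Ns, M = LTerm.apps (LTerm.var y) Ns := by
  induction h with
  | var y => exact ⟨y, [], rfl⟩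
  | @app M N _ _ ih =>
    obtain ⟨y, Ns, rfl⟩ := ih
    exact ⟨y, Ns ++ [N], by simp [LTerm.apps]⟩

theorem HeadNormal.isHnf {X : LTerm → Prop} {M : LTerm} (h : HeadNormal X M) : IsHnf M := by
  induction h with
  | neutral h => obtain ⟨y, Ns, rfl⟩ := h.exists_apps; exact ⟨0, y, Ns, rfl⟩
  | lam _ ih => obtain ⟨n, y, Ns, rfl⟩ := ih; exact ⟨n + 1, y, Ns, rfl⟩

theorem IsHnf.headNormal {M : LTerm} (h : IsHnf M) : HeadNormal (fun _ => True) M := by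
  obtain ⟨n, y, Ns, rfl⟩ := h
  exact headNormal_lams_apps n y fun _ _ => trivial

theorem Neutral.not_weakStep {X : LTerm → Prop} {M : LTerm} (h : Neutral X M)
    {G : LTerm → LTerm → Prop} : ∀ {N : LTerm}, ¬ WeakStep G M N := by
  induction h with
  | var y => intro N hs; cases hs
  | app hM _ ih =>
    intro N hs
    cases hs with
    | beta => cases hM
    | appL _ hs => exact ih hs

theorem HeadNormal.not_hStep {X : LTerm → Prop} {M : LTerm} (h : HeadNormal X M)
    {G : LTerm → LTerm → Prop} : ∀ {N : LTerm}, ¬ HStep G M N := by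
  induction h with
  | neutral h =>
    intro N hs
    cases hs with
    | weak hs => exact h.not_weakStep hs
    | lam => cases h
  | lam _ ih =>
    intro N hs
    cases hs with
    | weak hs => exact not_weakStep_lam hs
    | lam hs => exact ih hs

theorem Neutral.weakRed_eq {X : LTerm → Prop} {M N : LTerm} {k : ℕ} (h : Neutral X M)
    (hs : WeakRed k M N) : k = 0 ∧ N = M := by
  cases hs with
  | refl => exact ⟨rfl, rfl⟩
  | step hs _ => exact absurd hs h.not_weakStep

theorem Neutral.not_weakNonsimple {X : LTerm → Prop} {M : LTerm} (h : Neutral X M) :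
    ¬ WeakNonsimple M := by
  rintro ⟨k, Y, Z, hY, hZ⟩
  obtain ⟨-, rfl⟩ := h.weakRed_eq hY
  exact h.not_weakStep hZ

/-! ### Head reduction in the two presentations -/

theorem WeakStep.apps {G : LTerm → LTerm → Prop} (Ns : List LTerm) : ∀ {M N : LTerm},
    WeakStep G M N → WeakStep G (M.apps Ns) (N.apps Ns) := by
  induction Ns with
  | nil => intro M N h; exact h
  | cons K Ns ih => intro M N h; exact ih (.appL K h)

theorem HStep.lams {G : LTerm → LTerm → Prop} (n : ℕ) {M N : LTerm} (h : HStep G M N) :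
    HStep G (lams n M) (lams n N) := by
  induction n with
  | zero => exact h
  | succ n ih => exact .lam ih

theorem HeadStep.hStep {M N : LTerm} (h : HeadStep M N) : HStep AnyRedex M N := by
  obtain ⟨n, P, Q, Ns⟩ := h
  exact .lams n (.weak (.apps Ns (.beta P Q trivial)))

theorem SimpleHeadStep.hStep {M N : LTerm} (h : SimpleHeadStep M N) : HStep SimpleRedex M N := by
  obtain ⟨n, P, Q, Ns, h⟩ := h
  exact .lams n (.weak (.apps Ns (.beta P Q h)))

theorem WeakStep.exists_apps {G : LTerm → LTerm → Prop} {M N : LTerm} (h : WeakStep G M N) :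
    ∃ P Q Ns, M = LTerm.apps (LTerm.app (LTerm.lam P) Q) Ns ∧ N = LTerm.apps (P.inst Q) Ns := by
  induction h with
  | beta P Q _ => exact ⟨P, Q, [], rfl, rfl⟩
  | appL K _ ih =>
    obtain ⟨P, Q, Ns, rfl, rfl⟩ := ih
    exact ⟨P, Q, Ns ++ [K], by simp [LTerm.apps], by simp [LTerm.apps]⟩

theorem HStep.headStep {G : LTerm → LTerm → Prop} {M N : LTerm} (h : HStep G M N) :
    HeadStep M N := by
  induction h with
  | weak h => obtain ⟨P, Q, Ns, rfl, rfl⟩ := h.exists_apps; exact HeadStep.mk 0 P Q Ns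
  | lam _ ih => obtain ⟨n, P, Q, Ns⟩ := ih; exact HeadStep.mk (n + 1) P Q Ns

theorem headRed_iff {k : ℕ} {M N : LTerm} : HeadRed k M N ↔ Iter (HStep AnyRedex) k M N := by
  constructor
  · intro h
    induction h with
    | refl => exact .refl _
    | step h _ ih => exact .step h.hStep ih
  · intro h
    induction h with
    | refl => exact .refl _
    | step h _ ih => exact .step h.headStep ih

theorem Iter.head_unique {X Y : LTerm → Prop} {j : ℕ} {M H : LTerm}
    (h : Iter (HStep AnyRedex) j M H) (hH : HeadNormal X H) : ∀ {k : ℕ} {H' : LTerm},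
    Iter (HStep AnyRedex) k M H' → HeadNormal Y H' → k = j ∧ H' = H := by
  induction h with
  | refl =>
    intro k H' h' _
    cases h' with
    | refl => exact ⟨rfl, rfl⟩
    | step hs _ => exact absurd hs hH.not_hStep
  | step hs _ ih =>
    intro k H' h' hH'
    cases h' with
    | refl => exact absurd hs hH'.not_hStep
    | step hs' h' =>
      obtain ⟨rfl, -⟩ := hs.deterministic hs'
      obtain ⟨rfl, rfl⟩ := ih hH h' hH'
      exact ⟨rfl, rfl⟩

/-- Uniqueness of head reduction to head normal form determines the value chosen by
`Classical.epsilon`. -/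
theorem headReduct_eq {X : LTerm → Prop} {k : ℕ} {M H : LTerm}
    (h : Iter (HStep AnyRedex) k M H) (hH : HeadNormal X H) : headReduct M = (k, H) := by
  have hex : ∃ kH : ℕ × LTerm, HeadRed kH.1 M kH.2 ∧ IsHnf kH.2 :=
    ⟨(k, H), headRed_iff.2 h, hH.isHnf⟩
  have hsp := Classical.epsilon_spec hex
  have := h.head_unique hH (headRed_iff.1 hsp.1) hsp.2.headNormal
  exact Prod.ext this.1 this.2

theorem Iter.not_headNonsimple {X : LTerm → Prop} {k : ℕ} {M H : LTerm}
    (h : Iter (HStep SimpleRedex) k M H) (hH : HeadNormal X H) : ¬ HeadNonsimple M := by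
  induction h with
  | refl =>
    rintro ⟨j, Y, Z, hY, hZ⟩
    cases hY with
    | refl => exact hH.not_hStep hZ
    | step hs _ => exact hH.not_hStep hs
  | step hs _ ih =>
    rintro ⟨j, Y, Z, hY, hZ⟩
    cases hY with
    | refl => exact (hs.deterministic hZ).2.not_false fun _ _ h => h.2 h.1
    | step hs' hY =>
      obtain ⟨rfl, -⟩ := hs.deterministic hs'
      exact ih hH ⟨_, Y, Z, hY, hZ⟩

/-- The weak head reductions stored along the spine of `P` concatenate to one of `N`; the arguments
stay unreduced. -/
theorem Std.exists_weakRed_neutral {X : LTerm → Prop} {P : LTerm} (hP : Neutral X P) :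
    ∀ {w : ℕ} {N : LTerm}, Std w N P → ∃ k N', WeakRed k N N' ∧ Neutral (fun _ => True) N' := by
  induction hP with
  | var y =>
    intro w N h
    cases h with
    | var h _ => exact ⟨_, _, h, .var y⟩
  | app _ _ ih =>
    intro w N h
    cases h with
    | app h hA _ _ =>
      obtain ⟨k, A, hk, hA'⟩ := ih hA
      exact ⟨_, _, h.trans (hk.appL _), .app hA' trivial⟩

theorem Std.exists_head_normal {X : LTerm → Prop} {P : LTerm} (hP : HeadNormal X P) :
    ∀ {w : ℕ} {N : LTerm}, Std w N P →
      ∃ k N', Iter (HStep AnyRedex) k N N' ∧ HeadNormal (fun _ => True) N' := by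
  induction hP with
  | neutral hP =>
    intro w N h
    obtain ⟨k, N', hk, hN'⟩ := Std.exists_weakRed_neutral hP h
    exact ⟨k, N', hk.map id .weak, .neutral hN'⟩
  | lam _ ih =>
    intro w N h
    cases h with
    | lam h hA _ =>
      obtain ⟨k, A, hk, hA'⟩ := ih hA
      exact ⟨_, _, (h.map id .weak).trans (hk.map _ .lam), .lam hA'⟩

/-- A term that has a head normal form reaches one by head reduction. -/
theorem HasHnf.exists_iter {M : LTerm} (h : HasHnf M) :
    ∃ k H, Iter (HStep AnyRedex) k M H ∧ HeadNormal (fun _ => True) H := by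
  obtain ⟨H, hr, hH⟩ := h
  obtain ⟨w, hw⟩ := hr.exists_std
  exact Std.exists_head_normal hH.headNormal hw

/-! ### Reduction of head normal forms -/

theorem Red.of_var {i : ℕ} {P : LTerm} (h : Red (var i) P) : P = var i :=
  IsNormal.eq_of_red (fun _ hs => by cases hs) h

theorem Red.of_lam {A P : LTerm} (h : Red (LTerm.lam A) P) : ∃ A', P = LTerm.lam A' ∧ Red A A' := by
  induction h with
  | refl => exact ⟨A, rfl, .refl⟩
  | tail _ hs ih =>
    obtain ⟨A', rfl, hA⟩ := ih
    cases hs with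
    | lam hs => exact ⟨_, rfl, Relation.ReflTransGen.tail hA hs⟩

theorem Neutral.step {M N : LTerm} (h : Neutral (fun _ => True) M) : Step M N →
    Neutral (fun _ => True) N := by
  induction h generalizing N with
  | var y => intro hs; cases hs
  | app hM _ ih =>
    intro hs
    cases hs with
    | beta => cases hM
    | appL _ hs => exact .app (ih hs) trivial
    | appR _ hs => exact .app hM trivial

theorem Neutral.red {M N : LTerm} (h : Neutral (fun _ => True) M) (hr : Red M N) :
    Neutral (fun _ => True) N := by
  induction hr with
  | refl => exact h
  | tail _ hs ih => exact ih.step hs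

theorem HeadNormal.red {M : LTerm} (h : HeadNormal (fun _ => True) M) : ∀ {N : LTerm}, Red M N →
    HeadNormal (fun _ => True) N := by
  induction h with
  | neutral h => intro N hr; exact .neutral (h.red hr)
  | lam _ ih => intro N hr; obtain ⟨A', rfl, hA⟩ := hr.of_lam; exact .lam (ih hA)

theorem Red.of_neutral_app {A B P : LTerm} (hA : Neutral (fun _ => True) A)
    (h : Red (LTerm.app A B) P) : ∃ A' B', P = LTerm.app A' B' ∧ Red A A' ∧ Red B B' := by
  induction h with
  | refl => exact ⟨A, B, rfl, .refl, .refl⟩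
  | tail _ hs ih =>
    obtain ⟨A', B', rfl, hA', hB'⟩ := ih
    cases hs with
    | beta => cases hA.red hA'
    | appL _ hs => exact ⟨_, _, rfl, Relation.ReflTransGen.tail hA' hs, hB'⟩
    | appR _ hs => exact ⟨_, _, rfl, hA', Relation.ReflTransGen.tail hB' hs⟩

/-! ### Comparison of clocked Böhm trees -/

/-- `M` is simple and has a standard reduction of weight `w` to some reduct of `N`. -/
def Tracks (w : ℕ) (M N : LTerm) : Prop := Simple M ∧ ∃ P, Std w M P ∧ Red N P

/-- Parts of head normal forms that agree up to their arguments, which are related by `Tracks`;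
the weights of the arguments add up. -/
inductive FrameTracks : ℕ → LTerm → LTerm → Prop
  | var (i : ℕ) : FrameTracks 0 (var i) (var i)
  | lam {w : ℕ} {A A' : LTerm} (h : FrameTracks w A A') : FrameTracks w (lam A) (lam A')
  | app {a b : ℕ} {A A' B B' : LTerm} (hA : FrameTracks a A A') (hB : Tracks b B B') :
      FrameTracks (a + b) (app A B) (app A' B')

/-- A neutral term has no weak head step, so all weight on the spine of `H` sits in the arguments
and is divided among them. -/
theorem Neutral.frameTracks {H : LTerm} (hH : Neutral Simple H) : ∀ {w : ℕ} {N P : LTerm},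
    Neutral (fun _ => True) N → Std w H P → Red N P → ∃ v ≤ w, FrameTracks v H N := by
  induction hH with
  | var y =>
    intro w N P hN hs hr
    obtain rfl := hs.red.of_var
    cases hN with
    | var i =>
      cases hr.of_var
      exact ⟨0, Nat.zero_le _, .var _⟩
    | app hA _ => obtain ⟨A', B', h, -⟩ := Red.of_neutral_app hA hr; cases h
  | app hM hX ih =>
    intro w N P hN hs hr
    have hnn := (Neutral.app hM hX).not_weakNonsimple
    cases hs with
    | var h _ => cases ((Neutral.app hM hX).weakRed_eq h).2
    | lam h _ _ => cases ((Neutral.app hM hX).weakRed_eq h).2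
    | app h hA hB hw =>
      obtain ⟨rfl, h'⟩ := (Neutral.app hM hX).weakRed_eq h
      cases h'
      have hw := hw.resolve_left hnn
      cases hN with
      | var i => cases hr.of_var
      | app hN _ =>
        obtain ⟨A', B', h, hrA, hrB⟩ := Red.of_neutral_app hN hr
        cases h
        obtain ⟨v, hv, hf⟩ := ih hN hA hrA
        exact ⟨_, by omega, .app hf ⟨hX, _, hB, hrB⟩⟩

theorem HeadNormal.frameTracks {H : LTerm} (hH : HeadNormal Simple H) : ∀ {w : ℕ} {N P : LTerm},
    HeadNormal (fun _ => True) N → Std w H P → Red N P → ∃ v ≤ w, FrameTracks v H N := by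
  induction hH with
  | neutral hH =>
    intro w N P hN hs hr
    cases hN with
    | neutral hN => exact hH.frameTracks hN hs hr
    | lam _ =>
      obtain ⟨A', rfl, -⟩ := hr.of_lam
      cases hs with
      | lam h _ _ => obtain ⟨-, rfl⟩ := hH.weakRed_eq h; cases hH
  | lam _ ih =>
    intro w N P hN hs hr
    obtain ⟨A', rfl, hA⟩ := hs.of_lam
    cases hN with
    | neutral hN => cases hN.red hr
    | lam hN =>
      obtain ⟨A'', h, hA'⟩ := hr.of_lam
      cases h
      obtain ⟨v, hv, hf⟩ := ih hN hA hA'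
      exact ⟨v, hv, .lam hf⟩

theorem Simple.exists_iter {M : LTerm} (hM : Simple M) (h : HasHnf M) :
    ∃ k H, Iter (HStep SimpleRedex) k M H ∧ HeadNormal Simple H := by
  obtain ⟨X, hX, hMX⟩ := hM
  obtain ⟨n, y, Ns, hr, hNs⟩ := (hX M hMX).resolve_left (not_not.2 h)
  have : ∀ {A B : LTerm}, Relation.ReflTransGen SimpleHeadStep A B →
      ∃ k, Iter (HStep SimpleRedex) k A B := by
    intro A B hAB
    induction hAB using Relation.ReflTransGen.head_induction_on with
    | refl => exact ⟨0, .refl _⟩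
    | head hs _ ih => obtain ⟨k, hk⟩ := ih; exact ⟨k + 1, .step hs.hStep hk⟩
  obtain ⟨k, hk⟩ := this hr
  exact ⟨k, _, hk, headNormal_lams_apps n y fun N hN => ⟨X, hX, hNs N hN⟩⟩

/-- The excess of the clock of `M` over that of `N` is at most the weight lost in passing to the
arguments. -/
theorem Tracks.headReduct {w : ℕ} {M N : LTerm} (h : Tracks w M N) (hM : HasHnf M) :
    HasHnf N ∧ ∃ v ≤ w, FrameTracks v (headReduct M).2 (headReduct N).2 ∧
      (headReduct M).1 + v ≤ (headReduct N).1 + w := by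
  obtain ⟨hS, P, hs, hr⟩ := h
  obtain ⟨k, H, hk, hH⟩ := hS.exists_iter hM
  obtain ⟨j, v, P', hj, hv, hkv, hvw⟩ := Std.headRed hk (hk.not_headNonsimple hH) hs
  have hk' : Iter (HStep AnyRedex) k M H := hk.map id HStep.any
  have hP' : HeadNormal (fun _ => True) P' := hH.isHnf.headNormal.red hv.red
  have hN : HasHnf N :=
    ⟨P', Relation.ReflTransGen.trans hr (hj.red HStep.step), hP'.isHnf⟩
  obtain ⟨k', H', hk'', hH'⟩ := hN.exists_iter
  obtain ⟨j', P'', hj', hr', hjk⟩ := Red.headRed hk'' hr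
  -- The projections of the head reductions of `M` and `N` both lead from `P` to a head normal form,
  -- hence coincide; this links the two inequalities on step counts.
  obtain ⟨rfl, rfl⟩ := hj.head_unique hP' hj' (hH'.red hr')
  obtain ⟨u, hu, hf⟩ := hH.frameTracks hH' hv hr'
  rw [headReduct_eq hk' hH, headReduct_eq hk'' hH']
  exact ⟨hN, u, hu.trans hvw, hf, by simp only; omega⟩

/-- For the converse, a head normal form of `N` projects to one of the common reduct, which `M` also
reaches. -/
theorem Tracks.hasHnf_iff {w : ℕ} {M N : LTerm} (h : Tracks w M N) : HasHnf M ↔ HasHnf N := by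
  refine ⟨fun hM => (h.headReduct hM).1, fun hN => ?_⟩
  obtain ⟨-, P, hs, hr⟩ := h
  obtain ⟨k, H, hk, hH⟩ := hN.exists_iter
  obtain ⟨j, P', hj, hr', -⟩ := Red.headRed hk hr
  exact ⟨P', Relation.ReflTransGen.trans hs.red (hj.red HStep.step), (hH.red hr').isHnf⟩

/-- The relation between the states in the generation of two clocked Böhm trees. -/
inductive StateTracks : ℕ → BTState → BTState → Prop
  | eval {w : ℕ} {M N : LTerm} (h : Tracks w M N) : StateTracks w (.eval M) (.eval N)
  | frame {w : ℕ} {H K : LTerm} (h : FrameTracks w H K) : StateTracks w (.frame H) (.frame K)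

theorem StateTracks.resolve {w : ℕ} {s t : BTState} (h : StateTracks w s t) :
    (resolve s = none ∧ resolve t = none) ∨
      ∃ a b H K, resolve s = some (a, H) ∧ resolve t = some (b, K) ∧ ∃ v ≤ w, FrameTracks v H K ∧
        ((a = none ∧ b = none) ∨ ∃ j k, a = some j ∧ b = some k ∧ (j ≤ k ∨ v + 1 ≤ w)) := by
  cases h with
  | @eval M N h =>
    by_cases hM : HasHnf M
    · obtain ⟨hN, v, hv, hf, hk⟩ := h.headReduct hM
      exact .inr ⟨_, _, _, _, if_pos hM, if_pos hN, v, hv, hf, .inr ⟨_, _, rfl, rfl, by omega⟩⟩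
    · exact .inl ⟨if_neg hM, if_neg fun hN => hM (h.hasHnf_iff.2 hN)⟩
  | frame h => exact .inr ⟨_, _, _, _, rfl, rfl, w, le_rfl, h, .inl ⟨rfl, rfl⟩⟩

theorem FrameTracks.rootSym_eq {w : ℕ} {H K : LTerm} (h : FrameTracks w H K) :
    rootSym H = rootSym K := by
  cases h <;> rfl

/-- The budget is distributed over the children, not copied; this makes the count of worse positions
additive. -/
theorem FrameTracks.frameChild {w : ℕ} {H K : LTerm} (h : FrameTracks w H K) :
    ∃ c : Fin 3 → ℕ, c 0 + c 1 + c 2 ≤ w ∧ ∀ i,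
      (frameChild H i = none ∧ frameChild K i = none) ∨
        ∃ s t, frameChild H i = some s ∧ frameChild K i = some t ∧ StateTracks (c i) s t := by
  cases h with
  | var y => exact ⟨fun _ => 0, by simp, fun i => .inl ⟨rfl, rfl⟩⟩
  | lam h =>
    refine ⟨![w, 0, 0], by simp, fun i => ?_⟩
    fin_cases i
    · exact .inr ⟨_, _, rfl, rfl, .frame h⟩
    · exact .inl ⟨rfl, rfl⟩
    · exact .inl ⟨rfl, rfl⟩
  | @app a b _ _ _ _ hA hB =>
    refine ⟨![0, a, b], by simp, fun i => ?_⟩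
    fin_cases i
    · exact .inl ⟨rfl, rfl⟩
    · exact .inr ⟨_, _, rfl, rfl, .frame hA⟩
    · exact .inr ⟨_, _, rfl, rfl, .eval hB⟩

theorem unfold_nil_of_none {s : BTState} (h : resolve s = none) :
    unfold s [] = some ⟨NodeSym.bot, none⟩ := by
  rw [unfold, h]

theorem unfold_nil_of_some {s : BTState} {a : Option ℕ} {H : LTerm} (h : resolve s = some (a, H)) :
    unfold s [] = some ⟨rootSym H, a⟩ := by
  rw [unfold, h]

theorem unfold_cons_of_none {s : BTState} (h : resolve s = none) (i : Fin 3) (p : TreePos) :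
    unfold s (i :: p) = none := by
  rw [unfold, h]

theorem unfold_cons_of_some {s : BTState} {a : Option ℕ} {H : LTerm} (h : resolve s = some (a, H))
    (i : Fin 3) (p : TreePos) :
    unfold s (i :: p) = (frameChild H i).bind fun s' => unfold s' p := by
  rw [unfold, h]

theorem StateTracks.deannotate_eq (p : TreePos) : ∀ {w : ℕ} {s t : BTState}, StateTracks w s t →
    (unfold s).deannotate p = (unfold t).deannotate p := by
  induction p with
  | nil =>
    intro w s t h
    rcases h.resolve with ⟨hs, ht⟩ | ⟨a, b, H, K, hs, ht, v, -, hf, -⟩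
    · simp only [AnnTree.deannotate, unfold_nil_of_none hs, unfold_nil_of_none ht]
    · simp only [AnnTree.deannotate, unfold_nil_of_some hs, unfold_nil_of_some ht, Option.map_some,
        hf.rootSym_eq]
  | cons i p ih =>
    intro w s t h
    rcases h.resolve with ⟨hs, ht⟩ | ⟨a, b, H, K, hs, ht, v, -, hf, -⟩
    · simp only [AnnTree.deannotate, unfold_cons_of_none hs, unfold_cons_of_none ht]
    · obtain ⟨c, -, hc⟩ := hf.frameChild
      simp only [AnnTree.deannotate, unfold_cons_of_some hs, unfold_cons_of_some ht]
      rcases hc i with ⟨hH, hK⟩ | ⟨s', t', hH, hK, hst⟩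
      · rw [hH, hK]
      · rw [hH, hK]; exact ih hst

/-- The positions of `T₁` at which the annotation of `T₁` does not improve that of `T₂`. -/
def worsePositions (T₁ T₂ : AnnTree) : Set TreePos :=
  {p | p ∈ T₁.positions ∧ ¬ AnnTree.RelAt (· ≤ ·) T₁ T₂ p}

theorem encard_le_of_cons_mem {S : Set TreePos} {r : ℕ} {c : Fin 3 → ℕ} (hnil : [] ∈ S → 1 ≤ r)
    (hcons : ∀ i, {p | i :: p ∈ S}.encard ≤ c i) : S.encard ≤ (r + (c 0 + c 1 + c 2) : ℕ) := by
  have hsub : S ⊆ (S ∩ {[]}) ∪ ((List.cons 0 '' {p | 0 :: p ∈ S} ∪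
      List.cons 1 '' {p | 1 :: p ∈ S}) ∪ List.cons 2 '' {p | 2 :: p ∈ S}) := by
    rintro (_ | ⟨i, p⟩) hp
    · exact .inl ⟨hp, rfl⟩
    · refine .inr ?_
      fin_cases i
      · exact .inl (.inl ⟨p, hp, rfl⟩)
      · exact .inl (.inr ⟨p, hp, rfl⟩)
      · exact .inr ⟨p, hp, rfl⟩
  have hroot : (S ∩ {[]}).encard ≤ (r : ℕ∞) := by
    by_cases h : [] ∈ S
    · exact (Set.encard_le_encard Set.inter_subset_right).trans
        (by rw [Set.encard_singleton]; exact_mod_cast hnil h)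
    · have : S ∩ {[]} = ∅ := by
        ext p
        simp only [Set.mem_inter_iff, Set.mem_singleton_iff, Set.mem_empty_iff_false, iff_false]
        rintro ⟨hp, rfl⟩
        exact h hp
      simp [this]
  refine (Set.encard_le_encard hsub).trans ?_
  push_cast
  refine (Set.encard_union_le _ _).trans (add_le_add hroot ?_)
  refine (Set.encard_union_le _ _).trans
    (add_le_add ((Set.encard_union_le _ _).trans (add_le_add ?_ ?_)) ?_)
  all_goals exact (Set.encard_image_le _ _).trans (hcons _)

/-- The trees may be infinite and the weight need not decrease along a branch, so the induction is
on a depth cutoff; the bound does not depend on it. -/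
theorem StateTracks.encard_worsePositions_le (d : ℕ) : ∀ {w : ℕ} {s t : BTState},
    StateTracks w s t →
    {p | p ∈ worsePositions (unfold s) (unfold t) ∧ p.length < d}.encard ≤ w := by
  induction d with
  | zero => intro w s t _; simp
  | succ d ih =>
    intro w s t h
    rcases h.resolve with ⟨hs, ht⟩ | ⟨a, b, H, K, hs, ht, v, hv, hf, hab⟩
    · have : {p | p ∈ worsePositions (unfold s) (unfold t) ∧ p.length < d + 1} = ∅ := by
        ext p
        simp only [Set.mem_ofPred_eq, Set.mem_empty_iff_false, iff_false]
        rintro ⟨⟨hp, hn⟩, -⟩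
        cases p with
        | nil =>
          exact hn ⟨_, _, unfold_nil_of_none hs, unfold_nil_of_none ht, .inl ⟨rfl, rfl⟩⟩
        | cons i p => simp [AnnTree.positions, unfold_cons_of_none hs] at hp
      rw [this, Set.encard_empty]; exact zero_le
    · obtain ⟨c, hcv, hc⟩ := hf.frameChild
      -- The root gets the share `w - v`, which is at least 1 if its annotation is worse; the
      -- children share `v`.
      refine (encard_le_of_cons_mem (r := w - v) (c := c) ?_ fun i => ?_).trans
        (by exact_mod_cast (by omega : w - v + (c 0 + c 1 + c 2) ≤ w))
      · rintro ⟨⟨-, hn⟩, -⟩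
        by_contra hlt
        refine hn ⟨_, _, unfold_nil_of_some hs, unfold_nil_of_some ht, hab.imp_right ?_⟩
        rintro ⟨j, k, rfl, rfl, hjk⟩
        exact ⟨j, k, rfl, rfl, by omega⟩
      · rcases hc i with ⟨hH, hK⟩ | ⟨s', t', hH, hK, hst⟩
        · have : {p | i :: p ∈ {p | p ∈ worsePositions (unfold s) (unfold t) ∧
              p.length < d + 1}} = ∅ := by
            ext p
            simp only [Set.mem_ofPred_eq, Set.mem_empty_iff_false, iff_false]
            rintro ⟨⟨hp, -⟩, -⟩
            simp [AnnTree.positions, unfold_cons_of_some hs, hH] at hp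
          rw [this, Set.encard_empty]; exact zero_le
        · refine (Set.encard_le_encard ?_).trans (ih hst)
          have e₁ : ∀ p, unfold s (i :: p) = unfold s' p := fun p => by
            rw [unfold_cons_of_some hs, hH]; rfl
          have e₂ : ∀ p, unfold t (i :: p) = unfold t' p := fun p => by
            rw [unfold_cons_of_some ht, hK]; rfl
          rintro p ⟨⟨hp, hn⟩, hl⟩
          simp only [AnnTree.positions, AnnTree.RelAt, Set.mem_ofPred_eq, e₁, e₂] at hp hn
          exact ⟨⟨hp, hn⟩, by simpa using hl⟩

/-- Any `w + 1` elements of `S` would all lie within some finite depth, against the uniform bound;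
so `S` is finite. -/
theorem exists_length_bound {S : Set TreePos} {w : ℕ}
    (h : ∀ d, {p | p ∈ S ∧ p.length < d}.encard ≤ w) : ∃ l, ∀ p ∈ S, p.length < l := by
  have hfin : S.Finite := by
    by_contra hinf
    obtain ⟨F, hF, hcard⟩ := Set.Infinite.exists_subset_card_eq hinf (w + 1)
    have hsub : (F : Set TreePos) ⊆ {p | p ∈ S ∧ p.length < F.sup List.length + 1} :=
      fun p hp => ⟨hF hp, Nat.lt_succ_of_le (Finset.le_sup (f := List.length) hp)⟩
    have := (Set.encard_le_encard hsub).trans (h _)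
    rw [Set.encard_coe_eq_coe_finsetCard, hcard] at this
    have : w + 1 ≤ w := by exact_mod_cast this
    omega
  obtain ⟨l, hl⟩ := (hfin.image List.length).bddAbove
  exact ⟨l + 1, fun p hp => Nat.lt_succ_of_le (hl ⟨p, hp, rfl⟩)⟩

theorem Tracks.improvesEventually {w : ℕ} {M N : LTerm} (h : Tracks w M N) :
    ImprovesEventually M N := by
  refine ⟨funext fun p => StateTracks.deannotate_eq p (.eval h), ?_⟩
  obtain ⟨l, hl⟩ := exists_length_bound fun d =>
    StateTracks.encard_worsePositions_le d (.eval h)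
  exact ⟨l, fun p hp hlp => by_contra fun hn => absurd (hl p ⟨hp, hn⟩) (not_lt.2 hlp)⟩

end LTerm

theorem mainTheorem2 (M N : LTerm) (hM : LTerm.Simple M)
    (hMN : ¬ LTerm.ImprovesEventually M N) : ¬ LTerm.Conv M N := by
  intro hconv
  obtain ⟨P, hMP, hNP⟩ := hconv.exists_red
  obtain ⟨w, hw⟩ := hMP.exists_std
  exact hMN (LTerm.Tracks.improvesEventually ⟨hM, P, hw, hNP⟩)
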